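/- Let $q,a,b$ be complex numbers with $|q|<1$, $a\neq 0$, $b\neq 0$ and $\max\{|ab|,|aq^2|,|bq^2|\}<1$. Write $(x;p)_n=\prod_{k=0}^{n-1}(1-xp^k)$ and, for $|p|<1$, $(x;p)_\infty=\prod_{k=0}^{\infty}(1-xp^k)$, with $(x_1,\dots,x_m;p)_n=\prod_{i=1}^m (x_i;p)_n$ for $0\le n\le\infty$, and $$ {}_r\phi_s\left({a_1,\dots,a_r\atop b_1,\dots,b_s};p,z\right)=\sum_{n=0}^{\infty}\frac{(a_1,\dots,a_r;p)_n}{(p,b_1,\dots,b_s;p)_n}\left((-1)^np^{n(n-1)/2}\right)^{1+s-r}z^n . $$ Then both series over $n\ge 0$ in the following identity (the one defining ${}_3\phi_2$ and the one on the right-hand side) converge absolutely, and $$ \frac{(q^2,ab;q^2)_\infty}{(aq^2,bq^2;q^2)_\infty}\; {}_3\phi_2\left({q^2/a,\;q^2/b,\;q^2\atop 0,\;q^3};q^2,ab\right) =(1-q)\sum_{n=0}^{\infty}(1+q^{2n+1})\frac{(q^2/a,q^2/b;q^2)_n}{(aq^2,bq^2;q^2)_n}(-ab)^nq^{3n^2+2n}\sum_{j=-n}^{n}q^{-2j^2-j}.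 $$ (For $q=0$, the product $q^{3n^2+2n}\,q^{-2j^2-j}$ is read as $q^{3n^2+2n-2j^2-j}$, whose exponent is a nonnegative integer, with $0^0=1$.) -/

import Mathlib

noncomputable section

/-- The finite `q`-shifted factorial `(x;q)_n = ∏_{k=0}^{n-1} (1 - x q^k)`. -/
def qPoch (x q : ℂ) (n : ℕ) : ℂ :=
  ∏ k ∈ Finset.range n, (1 - x * q ^ k)

/-- The infinite `q`-shifted factorial `(x;q)_∞ = ∏_{k=0}^∞ (1 - x q^k)`, used for `|q| < 1`. -/
def qPochInf (x q : ℂ) : ℂ :=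
  ∏' k : ℕ, (1 - x * q ^ k)

/-- For `|q| < 1` the product defining `(x;q)_∞` converges, so that it is the limit of the
finite products `(x;q)_n`. -/
theorem tendsto_qPoch_qPochInf (x : ℂ) {q : ℂ} (hq : ‖q‖ < 1) :
    Filter.Tendsto (fun n => qPoch x q n) Filter.atTop (nhds (qPochInf x q)) := by
  have h : Multipliable fun k : ℕ => 1 - x * q ^ k := by
    have h1 : Multipliable fun k : ℕ => 1 + -(x * q ^ k) := by
      apply multipliable_one_add_of_summable
      simp only [norm_neg, norm_mul, norm_pow]
      exact (summable_geometric_of_lt_one (norm_nonneg q) hq).mul_left _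
    simpa only [sub_eq_add_neg] using h1
  exact h.tendsto_prod_tprod_nat

/-- Multiple-parameter notation `(x₁, …, x_m; q)_n = (x₁;q)_n ⋯ (x_m;q)_n`. -/
def qPochList (xs : List ℂ) (q : ℂ) (n : ℕ) : ℂ :=
  (xs.map fun x => qPoch x q n).prod

/-- Multiple-parameter notation `(x₁, …, x_m; q)_∞ = (x₁;q)_∞ ⋯ (x_m;q)_∞`. -/
def qPochInfList (xs : List ℂ) (q : ℂ) : ℂ :=
  (xs.map fun x => qPochInf x q).prod

/-- The `n`-th term of the basic hypergeometric series `_rφ_s(a₁,…,a_r; b₁,…,b_s; q, z)`, that is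
`(a₁,…,a_r;q)_n / (q,b₁,…,b_s;q)_n * ((-1)^n q^{n(n-1)/2})^{1+s-r} * z^n`.
Here `n.choose 2 = n(n-1)/2`. -/
def basicHypergeometricTerm (as bs : List ℂ) (q z : ℂ) (n : ℕ) : ℂ :=
  qPochList as q n / qPochList (q :: bs) q n *
    ((-1) ^ n * q ^ n.choose 2) ^ ((1 : ℤ) + (bs.length : ℤ) - (as.length : ℤ)) * z ^ n

/-- The basic hypergeometric series `_rφ_s(a₁,…,a_r; b₁,…,b_s; q, z)`. -/
def basicHypergeometric (as bs : List ℂ) (q z : ℂ) : ℂ :=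
  ∑' n : ℕ, basicHypergeometricTerm as bs q z n

/-- The `n`-th term
`(1+q^{2n+1}) (q²/a,q²/b;q²)_n / (aq²,bq²;q²)_n (-ab)^n q^{3n²+2n} ∑_{j=-n}^{n} q^{-2j²-j}`
of the Hecke-type series. -/
def heckeTerm (a b q : ℂ) (n : ℕ) : ℂ :=
  (1 + q ^ (2 * n + 1)) *
    (qPochList [q ^ 2 / a, q ^ 2 / b] (q ^ 2) n / qPochList [a * q ^ 2, b * q ^ 2] (q ^ 2) n) *
    (-(a * b)) ^ n * q ^ (3 * n ^ 2 + 2 * n) *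
    ∑ j ∈ Finset.Icc (-(n : ℤ)) (n : ℤ), q ^ (-2 * j ^ 2 - j)

end

/-!
The identity is an instance of Bailey's lemma. Put `p = q²`, `x = p/a`, `y = p/b` and `z = ab`, so
that `x y z = p²`, `x z = bp` and `y z = ap`.

The sequences `α_r` (`baileyAlpha`) and `1 / (q³;p)_n` form, up to constants, a Bailey pair
relative to `p`, that is
`1 / (q;p)_{n+1} = ∑_{r ≤ n} α_r / ((p;p)_{n-r} (p;p)_{n+r+1})`  (`sum_baileyKernel`).
Writing `B_n` for the right-hand side, one has to show `(1 - q^{2n+1}) B_n = B_{n-1}`. With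
`u(n,r) = 1 / ((p;p)_{n-r} (p;p)_{n+r+1})`, `v(n,r) = 1 / ((p;p)_{n-r} (p;p)_{n+r})` and
`S_r = ∑_{j=-r}^{r} q^{-2j²-j}`, the coefficient of `S_r` in the difference of the two sides
is a forward difference in `r` of `R(r) = -q^{2n} (-1)^r q^{3r²} v(n,r)`. Summation by parts leaves
a multiple of `∑_{r=-n}^{n} (-1)^r q^{r²-r} v(n,r)`, which telescopes as well once the terms for
`r` and `-r` are paired, and vanishes for `n ≥ 1`. The resulting
closed form of the partial sums, `one_sub_mul_sum_baileyAlpha_mul_baileyKernel`, is proved by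
induction.

Inserting this relation into `∑_n (x)_n (y)_n z^n / (q;p)_{n+1}`, which is the `₃φ₂` series divided
by `1 - q`, gives an absolutely convergent double series over `r` and `m = n - r`. Its inner sum
over `m` is a `q`-Gauss sum (`qGauss`), and the outer sum is then the Hecke-type series. The
`q`-Gauss sum itself follows from a contiguous relation between the arguments `z` and `zq`, whose
terms telescope (`gaussTerm_contiguous`), by iteration.
-/

open Filter Topology

/-! ### `q`-shifted factorials -/

theorem qPoch_succ (x q : ℂ) (n : ℕ) : qPoch x q (n + 1) = qPoch x q n * (1 - x * q ^ n) :=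
  Finset.prod_range_succ _ _

theorem qPoch_ne_zero {x q : ℂ} (h : ∀ k : ℕ, x * q ^ k ≠ 1) (n : ℕ) : qPoch x q n ≠ 0 :=
  Finset.prod_ne_zero_iff.2 fun k _ => sub_ne_zero.2 (h k).symm

theorem mul_pow_ne_one {x q : ℂ} (hx : ‖x‖ < 1) (hq : ‖q‖ < 1) (k : ℕ) : x * q ^ k ≠ 1 := by
  intro h
  have h1 : ‖x * q ^ k‖ < 1 := by
    rw [norm_mul, norm_pow]
    exact mul_lt_one_of_nonneg_of_lt_one_left (norm_nonneg _) hx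
      (pow_le_one₀ (norm_nonneg _) hq.le)
  simp [h] at h1

theorem norm_sq_lt_one {q : ℂ} (hq : ‖q‖ < 1) : ‖q ^ 2‖ < 1 := by
  rw [norm_pow]; exact pow_lt_one₀ (norm_nonneg _) hq two_ne_zero

theorem inv_qPoch_eq {x q : ℂ} (h : ∀ k : ℕ, x * q ^ k ≠ 1) (n : ℕ) :
    (qPoch x q n)⁻¹ = (1 - x * q ^ n) * (qPoch x q (n + 1))⁻¹ := by
  have h1 := qPoch_ne_zero h n
  have h2 : 1 - x * q ^ n ≠ 0 := sub_ne_zero.2 (h n).symm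
  rw [qPoch_succ]; field_simp

theorem qPochInf_ne_zero {x q : ℂ} (hq : ‖q‖ < 1) (h : ∀ k : ℕ, x * q ^ k ≠ 1) :
    qPochInf x q ≠ 0 := by
  have h1 := tprod_one_add_ne_zero_of_summable (f := fun k : ℕ => -(x * q ^ k))
    (fun k => by rw [← sub_eq_add_neg]; exact sub_ne_zero.2 (h k).symm)
    (by
      simp only [norm_neg, norm_mul, norm_pow]
      exact (summable_geometric_of_lt_one (norm_nonneg q) hq).mul_left _)
  simpa only [qPochInf, ← sub_eq_add_neg] using h1

theorem exists_norm_le_of_tendsto {f : ℕ → ℂ} {l : ℂ} (h : Tendsto f atTop (𝓝 l)) :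
    ∃ C, 0 ≤ C ∧ ∀ n, ‖f n‖ ≤ C := by
  obtain ⟨C, hC⟩ := h.norm.bddAbove_range
  have hC' : ∀ n, ‖f n‖ ≤ C := fun n => hC ⟨n, rfl⟩
  exact ⟨C, (norm_nonneg _).trans (hC' 0), hC'⟩

theorem exists_norm_qPoch_le (x : ℂ) {q : ℂ} (hq : ‖q‖ < 1) :
    ∃ C, 0 ≤ C ∧ ∀ n, ‖qPoch x q n‖ ≤ C :=
  exists_norm_le_of_tendsto (tendsto_qPoch_qPochInf x hq)

theorem exists_norm_inv_qPoch_le {x q : ℂ} (hq : ‖q‖ < 1) (h : ∀ k : ℕ, x * q ^ k ≠ 1) :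
    ∃ C, 0 ≤ C ∧ ∀ n, ‖(qPoch x q n)⁻¹‖ ≤ C :=
  exists_norm_le_of_tendsto ((tendsto_qPoch_qPochInf x hq).inv₀ (qPochInf_ne_zero hq h))

theorem qPoch_add (x q : ℂ) (m n : ℕ) :
    qPoch x q (m + n) = qPoch x q m * qPoch (x * q ^ m) q n := by
  simp only [qPoch, Finset.prod_range_add, pow_add, mul_assoc]

theorem qPochInf_eq_mul (x : ℂ) {q : ℂ} (hq : ‖q‖ < 1) (m : ℕ) :
    qPochInf x q = qPoch x q m * qPochInf (x * q ^ m) q := by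
  have h1 := (tendsto_qPoch_qPochInf (x * q ^ m) hq).const_mul (qPoch x q m)
  simp only [← qPoch_add] at h1
  have h2 : Tendsto (fun n => qPoch x q (m + n)) atTop (𝓝 (qPochInf x q)) := by
    simpa only [add_comm m] using (tendsto_add_atTop_iff_nat m).2 (tendsto_qPoch_qPochInf x hq)
  exact tendsto_nhds_unique h2 h1

/-! ### The `q`-Gauss sum -/

/-- The `n`-th term `(a)_n (b)_n z^n / ((q)_n (abz)_n)` of the `₂φ₁` series in Gauss's sum. The
argument `z` is the free parameter and the denominator parameter is `abz`, which avoids dividing by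
`a` and `b`. -/
noncomputable def gaussTerm (a b q z : ℂ) (n : ℕ) : ℂ :=
  qPoch a q n * qPoch b q n * ((qPoch q q n)⁻¹ * (qPoch (a * b * z) q n)⁻¹) * z ^ n

/-- A bound on the terms at `z q^N` that is uniform in `N`. -/
theorem exists_norm_gaussTerm_le {a b q z : ℂ} (hq : ‖q‖ < 1)
    (h : ∀ k : ℕ, a * b * z * q ^ k ≠ 1) :
    ∃ C, 0 ≤ C ∧ ∀ N n, ‖gaussTerm a b q (z * q ^ N) n‖ ≤ C * (‖z‖ ^ n * (‖q‖ ^ N) ^ n) := by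
  obtain ⟨A, hA0, hA⟩ := exists_norm_qPoch_le a hq
  obtain ⟨B, hB0, hB⟩ := exists_norm_qPoch_le b hq
  obtain ⟨P, hP0, hP⟩ := exists_norm_inv_qPoch_le hq (mul_pow_ne_one hq hq)
  obtain ⟨D, hD0, hD⟩ := exists_norm_qPoch_le (a * b * z) hq
  obtain ⟨E, hE0, hE⟩ := exists_norm_inv_qPoch_le hq h
  refine ⟨A * B * (P * (D * E)), by positivity, fun N n => ?_⟩
  have h1 : (qPoch (a * b * (z * q ^ N)) q n)⁻¹ =
      qPoch (a * b * z) q N * (qPoch (a * b * z) q (N + n))⁻¹ := by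
    rw [qPoch_add, ← mul_assoc (a * b), mul_inv, mul_inv_cancel_left₀ (qPoch_ne_zero h N)]
  rw [gaussTerm, h1]
  simp only [norm_mul, norm_pow, mul_pow]
  gcongr
  exacts [hA n, hB n, hP n, hD N, hE _]

theorem summable_gaussTerm {a b q z : ℂ} (hq : ‖q‖ < 1) (hz : ‖z‖ < 1)
    (h : ∀ k : ℕ, a * b * z * q ^ k ≠ 1) : Summable (gaussTerm a b q z) := by
  obtain ⟨C, -, hC⟩ := exists_norm_gaussTerm_le hq h
  refine Summable.of_norm_bounded ((summable_geometric_of_lt_one (norm_nonneg z) hz).mul_left C)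
    fun n => ?_
  simpa using hC 0 n

/-- The terms of the contiguous relation between `z` and `zq` telescope, with
`G_n = (1 - q^n) t_n(z)` up to a constant; here `G_0 = 0` and `G_n → 0`. -/
theorem gaussTerm_contiguous {a b q z : ℂ} (hq : ‖q‖ < 1)
    (h : ∀ k : ℕ, a * b * z * q ^ k ≠ 1) (n : ℕ) :
    (1 - a * b * z) * (1 - z) * gaussTerm a b q z n -
        (1 - a * z) * (1 - b * z) * gaussTerm a b q (z * q) n =
      (1 - a * b * z) * ((1 - q ^ n) * gaussTerm a b q z n -
        (1 - q ^ (n + 1)) * gaussTerm a b q z (n + 1)) := by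
  have h0 : 1 - a * b * z ≠ 0 := sub_ne_zero.2 (by simpa using (h 0).symm)
  -- both denominators are expressed through `(abz; q)_{n+1} = (1 - abz) (abzq; q)_n`
  have h1 : (qPoch (a * b * (z * q)) q n)⁻¹ =
      (1 - a * b * z) * (qPoch (a * b * z) q (n + 1))⁻¹ := by
    rw [add_comm n 1, qPoch_add, mul_inv, pow_one, mul_assoc (a * b) z q,
      show qPoch (a * b * z) q 1 = 1 - a * b * z by simp [qPoch], mul_inv_cancel_left₀ h0]
  simp only [gaussTerm]
  rw [h1, inv_qPoch_eq h n, inv_qPoch_eq (mul_pow_ne_one hq hq) n, qPoch_succ a, qPoch_succ b]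
  ring

theorem tsum_gaussTerm_contiguous {a b q z : ℂ} (hq : ‖q‖ < 1) (hz : ‖z‖ < 1)
    (h : ∀ k : ℕ, a * b * z * q ^ k ≠ 1) :
    (1 - a * b * z) * (1 - z) * ∑' n, gaussTerm a b q z n =
      (1 - a * z) * (1 - b * z) * ∑' n, gaussTerm a b q (z * q) n := by
  have hs : ∀ k : ℕ, a * b * (z * q) * q ^ k ≠ 1 := fun k => by
    have := h (k + 1); rwa [pow_succ', ← mul_assoc, mul_assoc (a * b)] at this
  have hzq : ‖z * q‖ < 1 := by
    rw [norm_mul]; exact mul_lt_one_of_nonneg_of_lt_one_left (norm_nonneg _) hz hq.le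
  have s1 := summable_gaussTerm hq hz h
  have s2 := summable_gaussTerm hq hzq hs
  have s3 : Summable fun n => (1 - q ^ n) * gaussTerm a b q z n := by
    refine Summable.of_norm_bounded (s1.norm.mul_left 2) fun n => ?_
    rw [norm_mul]
    gcongr
    calc ‖1 - q ^ n‖ ≤ ‖(1 : ℂ)‖ + ‖q ^ n‖ := norm_sub_le _ _
      _ ≤ 1 + 1 := by
        rw [norm_one, norm_pow]; gcongr; exact pow_le_one₀ (norm_nonneg _) hq.le
      _ = 2 := by norm_num
  have s4 := (summable_nat_add_iff 1).2 s3
  rw [← sub_eq_zero, ← tsum_mul_left, ← tsum_mul_left,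
    ← (s1.mul_left _).tsum_sub (s2.mul_left _)]
  simp only [gaussTerm_contiguous hq h]
  rw [tsum_mul_left, s3.tsum_sub s4, s3.tsum_eq_zero_add]
  simp

/-- The `q`-Gauss sum `₂φ₁(a, b; abz; q, z) = (az, bz; q)_∞ / (abz, z; q)_∞`, obtained by iterating
`tsum_gaussTerm_contiguous` and letting the argument `z q^N` tend to `0`. -/
theorem qGauss {a b q z : ℂ} (hq : ‖q‖ < 1) (hz : ‖z‖ < 1)
    (h : ∀ k : ℕ, a * b * z * q ^ k ≠ 1) :
    qPochInf (a * b * z) q * qPochInf z q * ∑' n, gaussTerm a b q z n =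
      qPochInf (a * z) q * qPochInf (b * z) q := by
  have hfin : ∀ N : ℕ, qPoch (a * b * z) q N * qPoch z q N * ∑' n, gaussTerm a b q z n =
      qPoch (a * z) q N * qPoch (b * z) q N * ∑' n, gaussTerm a b q (z * q ^ N) n := by
    intro N
    induction N with
    | zero => simp [qPoch]
    | succ N ih =>
      have hs : ∀ k : ℕ, a * b * (z * q ^ N) * q ^ k ≠ 1 := fun k => by
        have := h (N + k); rwa [pow_add, ← mul_assoc, mul_assoc (a * b)] at this
      have hzq : ‖z * q ^ N‖ < 1 := by
        rw [norm_mul, norm_pow]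
        exact mul_lt_one_of_nonneg_of_lt_one_left (norm_nonneg _) hz
          (pow_le_one₀ (norm_nonneg _) hq.le)
      have hc := tsum_gaussTerm_contiguous hq hzq hs
      rw [mul_assoc z, ← pow_succ] at hc
      simp only [qPoch_succ]
      linear_combination (1 - a * b * z * q ^ N) * (1 - z * q ^ N) * ih +
        qPoch (a * z) q N * qPoch (b * z) q N * hc
  have hlim : Tendsto (fun N : ℕ => ∑' n, gaussTerm a b q (z * q ^ N) n) atTop (𝓝 1) := by
    obtain ⟨C, hC0, hC⟩ := exists_norm_gaussTerm_le hq h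
    have h1 : (1 : ℂ) = ∑' n : ℕ, if n = 0 then 1 else 0 := by simp
    rw [h1]
    refine tendsto_tsum_of_dominated_convergence (bound := fun n => C * ‖z‖ ^ n)
      ((summable_geometric_of_lt_one (norm_nonneg z) hz).mul_left C) (fun n => ?_)
      (Eventually.of_forall fun N n => (hC N n).trans ?_)
    · rcases Nat.eq_zero_or_pos n with rfl | hn
      · simp [gaussTerm, qPoch]
      · rw [if_neg hn.ne']
        refine squeeze_zero_norm (fun N => hC N n) ?_
        have h2 : Tendsto (fun N : ℕ => (‖q‖ ^ N) ^ n) atTop (𝓝 (0 ^ n)) :=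
          (tendsto_pow_atTop_nhds_zero_of_lt_one (norm_nonneg _) hq).pow n
        rw [zero_pow hn.ne'] at h2
        simpa using (h2.const_mul (‖z‖ ^ n)).const_mul C
    · have : (‖q‖ ^ N) ^ n ≤ 1 :=
        pow_le_one₀ (by positivity) (pow_le_one₀ (norm_nonneg _) hq.le)
      gcongr
      exact mul_le_of_le_one_right (by positivity) this
  have hL := (((tendsto_qPoch_qPochInf (a * b * z) hq).mul
    (tendsto_qPoch_qPochInf z hq)).mul_const (∑' n, gaussTerm a b q z n))
  have hR := ((tendsto_qPoch_qPochInf (a * z) hq).mul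
    (tendsto_qPoch_qPochInf (b * z) hq)).mul hlim
  simp only [hfin, mul_one] at hL hR
  exact tendsto_nhds_unique hL hR

/-! ### The Bailey pair -/

/-- The polynomial `∑_{j=-r}^{r} q^{2r²+r-2j²-j}`, given by its recurrence in `r`. It is the inner
sum of the Hecke-type series cleared of negative powers, so that it also makes sense at `q = 0`;
see `heckeInner_eq`. -/
def heckeInner (q : ℂ) : ℕ → ℂ
  | 0 => 1
  | r + 1 => q ^ (4 * r + 3) * heckeInner q r + 1 + q ^ (2 * r + 2)

/-- The sequence `α_r = (1 + q^{2r+1}) (-1)^r q^{3r²+2r} ∑_{j=-r}^{r} q^{-2j²-j}`, which forms, up to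
a constant factor, a Bailey pair relative to `q²` in base `q²` with `β_n = 1 / (q³;q²)_n`; see
`sum_baileyKernel`. -/
def baileyAlpha (q : ℂ) (r : ℕ) : ℂ :=
  (1 + q ^ (2 * r + 1)) * (-1) ^ r * q ^ (r ^ 2 + r) * heckeInner q r

/-- The kernel `1 / ((p;p)_{n-r} (p;p)_{n+r+1})` of a Bailey pair relative to `p` in base `p`; the
subtraction is truncated, so it is meaningful for `r ≤ n` only. Since
`(p;p)_{n+r+1} = (1 - p) (p²;p)_{n+r}`, it is the usual kernel divided by `1 - p`. -/
noncomputable def baileyKernel (p : ℂ) (n r : ℕ) : ℂ :=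
  (qPoch p p (n - r))⁻¹ * (qPoch p p (n + r + 1))⁻¹

/-- Closed form of the partial sums of `(1 - q^{2n+1}) B_n - B_{n-1}`, where
`B_n = ∑_r α_r / ((p;p)_{n-r} (p;p)_{n+r+1})` and `p = q²`. Passing from `n` to `n - 1` multiplies
the kernel by `(1 - p^{n-r}) (1 - p^{n+r+1})`. The closed form contains the factor
`1 - p^{n-m}`, so it vanishes for `m = n`. -/
theorem one_sub_mul_sum_baileyAlpha_mul_baileyKernel {q : ℂ} (hq : ‖q‖ < 1) (n m : ℕ) (hm : m ≤ n) :
    (1 - q ^ (2 * n)) * ∑ r ∈ Finset.range (m + 1),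
      ((1 - q ^ (2 * n + 1)) - (1 - q ^ (2 * (n - r))) * (1 - q ^ (2 * (n + r + 1)))) *
        (baileyAlpha q r * baileyKernel (q ^ 2) n r) =
    q ^ (2 * n) * (-1) ^ m * (1 - q ^ (2 * (n - m))) * baileyKernel (q ^ 2) n m *
      ((1 - q ^ (2 * n)) * q ^ (m ^ 2 + 5 * m + 3) * heckeInner q m +
        q ^ (m ^ 2 + m) * (1 - q ^ (2 * (n + m + 1)))) := by
  induction m with
  | zero => simp [baileyAlpha, heckeInner]; ring
  | succ m ih =>
    obtain ⟨d, rfl⟩ := Nat.exists_eq_add_of_le hm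
    -- brings the kernel at `m`, which occurs in the induction hypothesis, to the one at `m + 1`
    have hk : (1 - q ^ (2 * (d + 1))) * baileyKernel (q ^ 2) (m + 1 + d) m =
        (1 - q ^ (2 * (2 * m + d + 3))) * baileyKernel (q ^ 2) (m + 1 + d) (m + 1) := by
      have hp := mul_pow_ne_one (norm_sq_lt_one hq) (norm_sq_lt_one hq)
      rw [baileyKernel, baileyKernel, show m + 1 + d - m = d + 1 by omega,
        show m + 1 + d - (m + 1) = d by omega, inv_qPoch_eq hp d,
        show m + 1 + d + (m + 1) + 1 = (m + 1 + d + m + 1) + 1 by ring,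
        inv_qPoch_eq hp (m + 1 + d + m + 1)]
      ring
    rw [Finset.sum_range_succ, mul_add, ih (by omega), show m + 1 + d - m = d + 1 by omega,
        show m + 1 + d - (m + 1) = d by omega]
    simp only [baileyAlpha, heckeInner]
    generalize baileyKernel (q ^ 2) (m + 1 + d) (m + 1) = w at *
    generalize baileyKernel (q ^ 2) (m + 1 + d) m = v at *
    generalize heckeInner q m = A
    linear_combination (q ^ (2 * (m + 1 + d)) * (-1) ^ m *
      ((1 - q ^ (2 * (m + 1 + d))) * q ^ (m ^ 2 + 5 * m + 3) * A +
        q ^ (m ^ 2 + m) * (1 - q ^ (2 * ((m + 1 + d) + m + 1))))) * hk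

/-- The Bailey pair relation: `∑_{r ≤ n} α_r / ((p;p)_{n-r} (p;p)_{n+r+1}) = 1 / (q;p)_{n+1}`
with `p = q²`. If `B_n` denotes the left-hand side, this follows from the recurrence
`(1 - q^{2n+1}) B_n = B_{n-1}`. -/
theorem sum_baileyKernel {q : ℂ} (hq : ‖q‖ < 1) (n : ℕ) :
    ∑ r ∈ Finset.range (n + 1), baileyAlpha q r * baileyKernel (q ^ 2) n r =
      (qPoch q (q ^ 2) (n + 1))⁻¹ := by
  have hp := mul_pow_ne_one (norm_sq_lt_one hq) (norm_sq_lt_one hq)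
  have hq' := mul_pow_ne_one hq (norm_sq_lt_one hq)
  induction n with
  | zero =>
    have h0 := hq' 0
    have h1 := hp 0
    have h2 : 1 - q ≠ 0 := sub_ne_zero.2 (by simpa using h0.symm)
    have h3 : 1 - q ^ 2 ≠ 0 := sub_ne_zero.2 (by simpa using h1.symm)
    simp [baileyAlpha, baileyKernel, heckeInner, qPoch]
    field_simp
    ring
  | succ N ih =>
    have key := one_sub_mul_sum_baileyAlpha_mul_baileyKernel hq (N + 1) (N + 1) le_rfl
    have hn : 1 - q ^ (2 * (N + 1)) ≠ 0 := by
      have := hp N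
      rw [sub_ne_zero]; intro h; apply this; rw [h]; ring
    simp only [Nat.sub_self, mul_zero, pow_zero, sub_self, zero_mul, mul_eq_zero, hn,
      false_or] at key
    simp only [sub_mul (1 - q ^ (2 * (N + 1) + 1)), Finset.sum_sub_distrib, ← Finset.mul_sum] at key
    -- the factor `1 - q^{2(N+1-r)}` kills the term `r = N + 1` and shifts the others to `N`
    have h2 : ∑ r ∈ Finset.range (N + 1 + 1), (1 - q ^ (2 * (N + 1 - r))) *
        (1 - q ^ (2 * (N + 1 + r + 1))) * (baileyAlpha q r * baileyKernel (q ^ 2) (N + 1) r) =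
        ∑ r ∈ Finset.range (N + 1), baileyAlpha q r * baileyKernel (q ^ 2) N r := by
      rw [Finset.sum_range_succ]
      simp only [Nat.sub_self, mul_zero, pow_zero, sub_self, zero_mul, add_zero]
      refine Finset.sum_congr rfl fun r hr => ?_
      obtain ⟨d, rfl⟩ := Nat.exists_eq_add_of_le (Nat.lt_succ_iff.1 (Finset.mem_range.1 hr))
      rw [baileyKernel, baileyKernel, show r + d + 1 - r = d + 1 by omega,
        show r + d - r = d by omega, inv_qPoch_eq hp d, inv_qPoch_eq hp (r + d + r + 1),
        show r + d + 1 + r + 1 = r + d + r + 1 + 1 by ring]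
      ring
    rw [h2, ih, sub_eq_zero] at key
    rw [inv_qPoch_eq hq' (N + 1)] at key
    have h4 : 1 - q ^ (2 * (N + 1) + 1) ≠ 0 := by
      have := hq' (N + 1)
      rw [sub_ne_zero]; intro h; apply this; rw [h]; ring
    refine mul_left_cancel₀ h4 (key.trans ?_)
    ring

/-! ### The double series -/

theorem summable_and_tsum_antidiagonal {f : ℕ × ℕ → ℂ} (hf : Summable f) :
    (Summable fun n => ∑ c ∈ Finset.HasAntidiagonal.antidiagonal n, f c) ∧
      ∑' n, ∑ c ∈ Finset.HasAntidiagonal.antidiagonal n, f c = ∑' r, ∑' m, f (r, m) := by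
  have h1 : HasSum (f ∘ Finset.HasAntidiagonal.sigmaAntidiagonalEquivProd) (∑' c, f c) :=
    Finset.HasAntidiagonal.sigmaAntidiagonalEquivProd.hasSum_iff.2 hf.hasSum
  have h2 : HasSum (fun n => ∑ c ∈ Finset.HasAntidiagonal.antidiagonal n, f c) (∑' c, f c) :=
    h1.sigma fun n => by
      have h3 := hasSum_fintype fun c : Finset.HasAntidiagonal.antidiagonal n => f c
      rwa [Finset.sum_coe_sort (Finset.HasAntidiagonal.antidiagonal n) f] at h3
  exact ⟨h2.summable, h2.tsum_eq.trans hf.tsum_prod⟩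

theorem norm_heckeInner_le {q : ℂ} (hq : ‖q‖ < 1) (r : ℕ) : ‖heckeInner q r‖ ≤ 2 * r + 1 := by
  have hp : ∀ k : ℕ, ‖q ^ k‖ ≤ 1 := fun k => by
    rw [norm_pow]; exact pow_le_one₀ (norm_nonneg _) hq.le
  induction r with
  | zero => simp [heckeInner]
  | succ r ih =>
    calc ‖heckeInner q (r + 1)‖
        ≤ ‖q ^ (4 * r + 3)‖ * ‖heckeInner q r‖ + ‖(1 : ℂ)‖ + ‖q ^ (2 * r + 2)‖ := by
          rw [heckeInner, ← norm_mul]; exact norm_add₃_le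
      _ ≤ 1 * (2 * r + 1) + 1 + 1 := by
          rw [norm_one]; gcongr; exacts [hp _, hp _]
      _ = 2 * (r + 1 : ℕ) + 1 := by push_cast; ring

theorem norm_baileyAlpha_le {q : ℂ} (hq : ‖q‖ < 1) (r : ℕ) :
    ‖baileyAlpha q r‖ ≤ 2 * (2 * r + 1) := by
  have hp : ∀ k : ℕ, ‖q ^ k‖ ≤ 1 := fun k => by
    rw [norm_pow]; exact pow_le_one₀ (norm_nonneg _) hq.le
  have h1 : ‖1 + q ^ (2 * r + 1)‖ ≤ 1 + 1 :=
    (norm_add_le _ _).trans (by rw [norm_one]; gcongr; exact hp _)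
  calc ‖baileyAlpha q r‖
      = ‖1 + q ^ (2 * r + 1)‖ * ‖q ^ (r ^ 2 + r)‖ * ‖heckeInner q r‖ := by
        simp [baileyAlpha]
    _ ≤ (1 + 1) * 1 * (2 * r + 1) := by
        gcongr; exacts [hp _, norm_heckeInner_le hq r]
    _ = 2 * (2 * r + 1) := by ring

theorem summable_baileyAlpha_mul_pow {q z : ℂ} (hq : ‖q‖ < 1) (hz : ‖z‖ < 1) :
    Summable fun r => ‖z ^ r * baileyAlpha q r‖ := by
  have h1 : Summable fun r : ℕ => (r : ℝ) ^ 1 * ‖z‖ ^ r :=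
    summable_pow_mul_geometric_of_norm_lt_one 1 (by simpa using hz)
  have h2 := summable_geometric_of_lt_one (norm_nonneg z) hz
  refine Summable.of_nonneg_of_le (fun _ => norm_nonneg _) (fun r => ?_)
    ((h1.mul_left 4).add (h2.mul_left 2))
  rw [norm_mul, norm_pow]
  calc ‖z‖ ^ r * ‖baileyAlpha q r‖ ≤ ‖z‖ ^ r * (2 * (2 * r + 1)) := by
        gcongr; exact norm_baileyAlpha_le hq r
    _ = _ := by ring

/-- The `(r, m)` term of the double series that results from inserting the Bailey pair relation into
`∑_n (x)_n (y)_n z^n / (q;q²)_{n+1}`, where `n = r + m`. -/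
noncomputable def baileyDoubleTerm (q x y z : ℂ) (c : ℕ × ℕ) : ℂ :=
  qPoch x (q ^ 2) (c.1 + c.2) * qPoch y (q ^ 2) (c.1 + c.2) * z ^ (c.1 + c.2) *
    (baileyAlpha q c.1 * baileyKernel (q ^ 2) (c.1 + c.2) c.1)

theorem summable_baileyDoubleTerm {q x y z : ℂ} (hq : ‖q‖ < 1) (hz : ‖z‖ < 1) :
    Summable (baileyDoubleTerm q x y z) := by
  have hp := norm_sq_lt_one hq
  obtain ⟨A, hA0, hA⟩ := exists_norm_qPoch_le x hp
  obtain ⟨B, hB0, hB⟩ := exists_norm_qPoch_le y hp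
  obtain ⟨P, hP0, hP⟩ := exists_norm_inv_qPoch_le hp (mul_pow_ne_one hp hp)
  have h1 := (summable_baileyAlpha_mul_pow hq hz).mul_of_nonneg
    (summable_geometric_of_lt_one (norm_nonneg z) hz) (fun _ => norm_nonneg _)
    (fun _ => by positivity)
  refine Summable.of_norm_bounded (h1.mul_left (A * B * (P * P))) fun c => ?_
  calc ‖baileyDoubleTerm q x y z c‖
      = ‖qPoch x (q ^ 2) (c.1 + c.2)‖ * ‖qPoch y (q ^ 2) (c.1 + c.2)‖ *
        (‖(qPoch (q ^ 2) (q ^ 2) (c.1 + c.2 - c.1))⁻¹‖ *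
          ‖(qPoch (q ^ 2) (q ^ 2) (c.1 + c.2 + c.1 + 1))⁻¹‖) *
        (‖z ^ c.1 * baileyAlpha q c.1‖ * ‖z‖ ^ c.2) := by
        simp only [baileyDoubleTerm, baileyKernel, norm_mul, norm_pow, pow_add]; ring
    _ ≤ A * B * (P * P) * (‖z ^ c.1 * baileyAlpha q c.1‖ * ‖z‖ ^ c.2) := by
        gcongr; exacts [hA _, hB _, hP _, hP _]

/-- The row sums of the double series are `q`-Gauss sums with parameters `x q^{2r}`, `y q^{2r}` and
argument `z`. This is Bailey's lemma, row by row. -/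
theorem tsum_baileyDoubleTerm {q x y z : ℂ} (hq : ‖q‖ < 1) (hz : ‖z‖ < 1)
    (hxyz : x * y * z = (q ^ 2) ^ 2) (hxz : ‖x * z‖ < 1) (hyz : ‖y * z‖ < 1) (r : ℕ) :
    qPochInf (q ^ 2) (q ^ 2) * qPochInf z (q ^ 2) * ∑' m, baileyDoubleTerm q x y z (r, m) =
      qPochInf (x * z) (q ^ 2) * qPochInf (y * z) (q ^ 2) *
        (qPoch x (q ^ 2) r * qPoch y (q ^ 2) r * z ^ r * baileyAlpha q r /
          (qPoch (x * z) (q ^ 2) r * qPoch (y * z) (q ^ 2) r)) := by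
  have hp := norm_sq_lt_one hq
  have hpp := mul_pow_ne_one hp hp
  have hc : ∀ s : ℂ, x * s * (y * s) * z = (q ^ 2) ^ 2 * s ^ 2 := fun s => by
    rw [← hxyz]; ring
  have hne : ∀ k : ℕ, x * (q ^ 2) ^ r * (y * (q ^ 2) ^ r) * z * (q ^ 2) ^ k ≠ 1 := fun k => by
    have := hpp (2 * r + 1 + k)
    rw [hc]; convert this using 1; ring
  have hG := qGauss hp hz hne
  have hterm : ∀ m, baileyDoubleTerm q x y z (r, m) =
      qPoch x (q ^ 2) r * qPoch y (q ^ 2) r * z ^ r * baileyAlpha q r *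
        (qPoch (q ^ 2) (q ^ 2) (2 * r + 1))⁻¹ *
        gaussTerm (x * (q ^ 2) ^ r) (y * (q ^ 2) ^ r) (q ^ 2) z m := fun m => by
    simp only [baileyDoubleTerm, baileyKernel, gaussTerm]
    rw [Nat.add_sub_cancel_left, show r + m + r + 1 = (2 * r + 1) + m by ring,
      qPoch_add _ _ (2 * r + 1), qPoch_add x, qPoch_add y, hc,
      show (q ^ 2) ^ 2 * ((q ^ 2) ^ r) ^ 2 = q ^ 2 * (q ^ 2) ^ (2 * r + 1) by ring, mul_inv]
    ring
  simp only [hterm]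
  rw [tsum_mul_left, qPochInf_eq_mul (q ^ 2) hp (2 * r + 1), qPochInf_eq_mul (x * z) hp r,
    qPochInf_eq_mul (y * z) hp r]
  rw [hc, show (q ^ 2) ^ 2 * ((q ^ 2) ^ r) ^ 2 = q ^ 2 * (q ^ 2) ^ (2 * r + 1) by ring,
    show x * (q ^ 2) ^ r * z = x * z * (q ^ 2) ^ r by ring,
    show y * (q ^ 2) ^ r * z = y * z * (q ^ 2) ^ r by ring] at hG
  have n1 := qPoch_ne_zero hpp (2 * r + 1)
  have n2 := qPoch_ne_zero (mul_pow_ne_one hxz hp) r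
  have n3 := qPoch_ne_zero (mul_pow_ne_one hyz hp) r
  generalize ∑' m, gaussTerm (x * (q ^ 2) ^ r) (y * (q ^ 2) ^ r) (q ^ 2) z m = G at *
  generalize qPochInf (x * z * (q ^ 2) ^ r) (q ^ 2) = X at *
  generalize qPochInf (y * z * (q ^ 2) ^ r) (q ^ 2) = Y at *
  generalize qPoch (x * z) (q ^ 2) r = U at *
  generalize qPoch (y * z) (q ^ 2) r = V at *
  field_simp
  linear_combination (qPoch x (q ^ 2) r * qPoch y (q ^ 2) r * z ^ r * baileyAlpha q r) * hG

/-! ### The Hecke-type series -/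

theorem heckeInner_eq {q : ℂ} (hq0 : q ≠ 0) (n : ℕ) :
    q ^ (2 * n ^ 2 + n) * ∑ j ∈ Finset.Icc (-(n : ℤ)) (n : ℤ), q ^ (-2 * j ^ 2 - j) =
      heckeInner q n := by
  induction n with
  | zero => simp [heckeInner]
  | succ n ih =>
    have hI : Finset.Icc (-((n + 1 : ℕ) : ℤ)) ((n + 1 : ℕ) : ℤ) =
        insert ((n : ℤ) + 1) (insert (-((n : ℤ) + 1)) (Finset.Icc (-(n : ℤ)) (n : ℤ))) := by
      ext j; simp only [Finset.mem_Icc, Finset.mem_insert]; push_cast; omega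
    rw [hI, Finset.sum_insert (by simp; omega), Finset.sum_insert (by simp), heckeInner, ← ih]
    have e1 : q ^ (2 * (n + 1) ^ 2 + (n + 1)) * q ^ (-2 * ((n : ℤ) + 1) ^ 2 - (n + 1)) = 1 := by
      rw [← zpow_natCast, ← zpow_add₀ hq0]
      convert zpow_zero q using 2; push_cast; ring
    have e2 : q ^ (2 * (n + 1) ^ 2 + (n + 1)) * q ^ (-2 * (-((n : ℤ) + 1)) ^ 2 - -((n : ℤ) + 1)) =
        q ^ (2 * n + 2) := by
      rw [← zpow_natCast, ← zpow_natCast, ← zpow_add₀ hq0]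
      congr 1; push_cast; ring
    rw [mul_add, mul_add, e1, e2]
    ring

/-- The terms of the Hecke-type series in the shape in which Bailey's lemma produces them. -/
theorem heckeTerm_eq (a b q : ℂ) (n : ℕ) :
    heckeTerm a b q n =
      qPoch (q ^ 2 / a) (q ^ 2) n * qPoch (q ^ 2 / b) (q ^ 2) n * (a * b) ^ n * baileyAlpha q n /
        (qPoch (a * q ^ 2) (q ^ 2) n * qPoch (b * q ^ 2) (q ^ 2) n) := by
  have h : q ^ (3 * n ^ 2 + 2 * n) *
      ∑ j ∈ Finset.Icc (-(n : ℤ)) (n : ℤ), q ^ (-2 * j ^ 2 - j) =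
      q ^ (n ^ 2 + n) * heckeInner q n := by
    -- for `q = 0` both sides are `1` if `n = 0`, and both vanish if `n > 0`
    rcases eq_or_ne q 0 with rfl | hq0
    · rcases Nat.eq_zero_or_pos n with rfl | hn
      · simp [heckeInner]
      · rw [zero_pow (by positivity), zero_pow (by positivity), zero_mul, zero_mul]
    · rw [← heckeInner_eq hq0]; ring
  rw [heckeTerm, mul_assoc _ (q ^ _), h, neg_pow]
  simp only [qPochList, List.map_cons, List.map_nil, List.prod_cons, List.prod_nil, mul_one,
    baileyAlpha]
  ring

theorem mainTheorem2 (a b q : ℂ) (hq : ‖q‖ < 1) (ha : a ≠ 0) (hb : b ≠ 0)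
    (hmax : max ‖a * b‖ (max ‖a * q ^ 2‖ ‖b * q ^ 2‖) < 1) :
    Summable (basicHypergeometricTerm [q ^ 2 / a, q ^ 2 / b, q ^ 2] [0, q ^ 3] (q ^ 2) (a * b)) ∧
    Summable (heckeTerm a b q) ∧
    qPochInfList [q ^ 2, a * b] (q ^ 2) / qPochInfList [a * q ^ 2, b * q ^ 2] (q ^ 2) *
        basicHypergeometric [q ^ 2 / a, q ^ 2 / b, q ^ 2] [0, q ^ 3] (q ^ 2) (a * b) =
      (1 - q) * ∑' n : ℕ, heckeTerm a b q n := by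
  obtain ⟨hz, hap, hbp⟩ : ‖a * b‖ < 1 ∧ ‖a * q ^ 2‖ < 1 ∧ ‖b * q ^ 2‖ < 1 := by
    simpa only [max_lt_iff] using hmax
  have hp := norm_sq_lt_one hq
  have hpp := mul_pow_ne_one hp hp
  have hxz : q ^ 2 / a * (a * b) = b * q ^ 2 := by field_simp
  have hyz : q ^ 2 / b * (a * b) = a * q ^ 2 := by field_simp
  have hxyz : q ^ 2 / a * (q ^ 2 / b) * (a * b) = (q ^ 2) ^ 2 := by field_simp
  have hsum := summable_baileyDoubleTerm (x := q ^ 2 / a) (y := q ^ 2 / b) hq hz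
  obtain ⟨hs, hts⟩ := summable_and_tsum_antidiagonal hsum
  have hrow := tsum_baileyDoubleTerm (x := q ^ 2 / a) (y := q ^ 2 / b) hq hz hxyz
    (by rwa [hxz]) (by rwa [hyz])
  simp only [hxz, hyz] at hrow
  -- the antidiagonal sums of the double series give the hypergeometric series
  have hterm : ∀ n, basicHypergeometricTerm [q ^ 2 / a, q ^ 2 / b, q ^ 2] [0, q ^ 3] (q ^ 2)
      (a * b) n = (1 - q) * ∑ c ∈ Finset.HasAntidiagonal.antidiagonal n,
        baileyDoubleTerm q (q ^ 2 / a) (q ^ 2 / b) (a * b) c := fun n => by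
    have h1 : ∑ c ∈ Finset.HasAntidiagonal.antidiagonal n,
        baileyDoubleTerm q (q ^ 2 / a) (q ^ 2 / b) (a * b) c =
        qPoch (q ^ 2 / a) (q ^ 2) n * qPoch (q ^ 2 / b) (q ^ 2) n * (a * b) ^ n *
          (qPoch q (q ^ 2) (n + 1))⁻¹ := by
      rw [← sum_baileyKernel hq n, Finset.mul_sum,
        ← Finset.Nat.sum_antidiagonal_eq_sum_range_succ_mk (n := n) (f := fun c =>
          qPoch (q ^ 2 / a) (q ^ 2) n * qPoch (q ^ 2 / b) (q ^ 2) n * (a * b) ^ n *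
            (baileyAlpha q c.1 * baileyKernel (q ^ 2) n c.1))]
      refine Finset.sum_congr rfl fun c hc => ?_
      rw [baileyDoubleTerm, Finset.HasAntidiagonal.mem_antidiagonal.1 hc]
    have h2 : qPoch q (q ^ 2) (n + 1) = (1 - q) * qPoch (q ^ 3) (q ^ 2) n := by
      rw [add_comm, qPoch_add, show q * (q ^ 2) ^ 1 = q ^ 3 by ring]
      simp [qPoch]
    have h3 : 1 - q ≠ 0 := by
      rw [sub_ne_zero]; rintro rfl; simp at hq
    have h4 : qPoch 0 (q ^ 2) n = 1 := by simp [qPoch]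
    have h5 := qPoch_ne_zero hpp n
    rw [h1, h2, basicHypergeometricTerm]
    simp only [qPochList, List.map_cons, List.map_nil, List.prod_cons, List.prod_nil, mul_one,
      List.length_cons, List.length_nil, h4]
    norm_num
    field_simp
  have na := qPochInf_ne_zero hp (mul_pow_ne_one hap hp)
  have nb := qPochInf_ne_zero hp (mul_pow_ne_one hbp hp)
  -- its row sums give the Hecke-type series
  have hhecke : ∀ r, heckeTerm a b q r =
      qPochInf (q ^ 2) (q ^ 2) * qPochInf (a * b) (q ^ 2) /
        (qPochInf (a * q ^ 2) (q ^ 2) * qPochInf (b * q ^ 2) (q ^ 2)) *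
        ∑' m, baileyDoubleTerm q (q ^ 2 / a) (q ^ 2 / b) (a * b) (r, m) := fun r => by
    rw [div_mul_eq_mul_div, hrow, heckeTerm_eq, mul_comm (qPochInf (b * q ^ 2) (q ^ 2)),
      mul_div_cancel_left₀ _ (mul_ne_zero na nb), mul_comm (qPoch (b * q ^ 2) (q ^ 2) r)]
  refine ⟨(hs.mul_left (1 - q)).congr fun n => (hterm n).symm,
    (hsum.prod.mul_left _).congr fun r => (hhecke r).symm, ?_⟩
  rw [basicHypergeometric]
  simp only [hterm, hhecke]
  rw [tsum_mul_left, tsum_mul_left, hts]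
  simp only [qPochInfList, List.map_cons, List.map_nil, List.prod_cons, List.prod_nil, mul_one]
  ring
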